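/- Let $\mathbb G=(\mathbb R^n,\circ,\delta_\lambda)$ be a stratified group (homogeneous Carnot group). That is, $\mathbb R^n=\mathbb R^{N}\times\mathbb R^{N_2}\times\cdots\times\mathbb R^{N_r}$ carries a smooth group law $\circ$ with neutral element $0$ for which every dilation $\delta_\lambda(x',x^{(2)},\dots,x^{(r)})=(\lambda x',\lambda^2x^{(2)},\dots,\lambda^rx^{(r)})$, $\lambda>0$, is an automorphism, and the left invariant vector fields $X_1,\dots,X_N$ with $X_k(0)=\partial/\partial x'_k|_0$ generate a Lie algebra of vector fields of rank $n$ at every point. Let $\mathcal L=\sum_{k=1}^N X_k^2$ be the sub-Laplacian, let $|x'|$ be the Euclidean norm of the component $x'\in\mathbb R^N$ of $x$ in the first stratum, and let $dx$ be Lebesgue measure on $\mathbb R^n$. Let $1\le p<\infty$ and $2<\alpha<N$. Then for every complex-valued $u\in C_0^\infty(\mathbb G\setminus\{x'=0\})$ both integrals below are finite and $$\int_{\mathbb G}\frac{|u|^p}{|x'|^{\alpha}}\,dx\le C_{(N,p,\alpha)}^p\int_{\mathbb G}\frac{|\mathcal Lu|^p}{|x'|^{\alpha-2p}}\,dx,\qquad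 C_{(N,p,\alpha)}=\frac{p^2}{(N-\alpha)\left((p-1)N+\alpha-2p\right)}.$$ -/

import Mathlib

open MeasureTheory
open scoped ContDiff

noncomputable section

namespace Carnot

/-- The space `ℝⁿ = ℝ^{d 0} × ⋯ × ℝ^{d (r-1)}` of points `x = (x', x⁽²⁾, …, x⁽ʳ⁾)`; the coordinate
with index `⟨l, m⟩` is the `m`-th variable of the stratum number `l + 1`. -/
abbrev Space {r : ℕ} (d : Fin r → ℕ) : Type := (Σ l : Fin r, Fin (d l)) → ℝ

/-- The dilation `δ_t (x', x⁽²⁾, …, x⁽ʳ⁾) = (t x', t² x⁽²⁾, …, tʳ x⁽ʳ⁾)`. -/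
def dilation {r : ℕ} {d : Fin r → ℕ} (t : ℝ) (x : Space d) : Space d :=
  fun i => t ^ ((i.1 : ℕ) + 1) * x i

/-- A homogeneous Lie group `(ℝⁿ, ∘, δ_t)`: a smooth group law on `ℝⁿ` with neutral element `0`
for which all dilations `δ_t`, `t > 0`, are automorphisms. -/
structure HomogeneousGroup {r : ℕ} (d : Fin r → ℕ) where
  mul : Space d → Space d → Space d
  inv : Space d → Space d
  mul_assoc : ∀ x y z, mul (mul x y) z = mul x (mul y z)
  zero_mul : ∀ x, mul 0 x = x
  mul_zero : ∀ x, mul x 0 = x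
  inv_mul : ∀ x, mul (inv x) x = 0
  contDiff_mul : ContDiff ℝ ∞ (fun z : Space d × Space d => mul z.1 z.2)
  contDiff_inv : ContDiff ℝ ∞ inv
  dilation_mul : ∀ t : ℝ, 0 < t → ∀ x y,
    dilation t (mul x y) = mul (dilation t x) (dilation t y)

/-- The Jacobian generator `X_k`: the left invariant vector field on the group, given by the
differentials of the left translations, with `X_k(0) = ∂/∂x'_k`. -/
def HomogeneousGroup.X {r : ℕ} [NeZero r] {d : Fin r → ℕ} (G : HomogeneousGroup d)
    (k : Fin (d 0)) (x : Space d) : Space d :=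
  fderiv ℝ (fun y => G.mul x y) 0 (Pi.single ⟨0, k⟩ 1)

/-- Membership in the Lie algebra of vector fields on `ℝⁿ` generated by `X_1, …, X_N`,
`N = d 0`. -/
inductive HomogeneousGroup.MemLie {r : ℕ} [NeZero r] {d : Fin r → ℕ} (G : HomogeneousGroup d) :
    (Space d → Space d) → Prop
  | generator (k : Fin (d 0)) : MemLie G (G.X k)
  | zero : MemLie G 0
  | add {A B : Space d → Space d} : MemLie G A → MemLie G B → MemLie G (A + B)
  | smul (c : ℝ) {A : Space d → Space d} : MemLie G A → MemLie G (c • A)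
  | bracket {A B : Space d → Space d} : MemLie G A → MemLie G B →
      MemLie G (VectorField.lieBracket ℝ A B)

/-- A stratified group (homogeneous Carnot group): a homogeneous Lie group whose Jacobian
generators satisfy the rank condition, i.e. the Lie algebra generated by `X_1, …, X_N` has
rank `n` at every point of `ℝⁿ`. -/
structure StratifiedGroup {r : ℕ} [NeZero r] (d : Fin r → ℕ) extends HomogeneousGroup d where
  rank_condition : ∀ x v : Space d, ∃ A, toHomogeneousGroup.MemLie A ∧ A x = v

variable {r : ℕ} [NeZero r] {d : Fin r → ℕ}

/-- The derivative `X_k f` of a function along the vector field `X_k`. -/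
def StratifiedGroup.derivX (G : StratifiedGroup d) (k : Fin (d 0)) (f : Space d → ℂ) :
    Space d → ℂ :=
  fun x => fderiv ℝ f x (G.X k x)

/-- The sub-Laplacian `𝓛 = ∑_{k=1}^N X_k²`. -/
def StratifiedGroup.subLaplacian (G : StratifiedGroup d) (f : Space d → ℂ) : Space d → ℂ :=
  fun x => ∑ k : Fin (d 0), G.derivX k (G.derivX k f) x

/-- The Euclidean norm `|x'|` of the first stratum component of `x`. -/
def horizontalNorm (x : Space d) : ℝ :=
  Real.sqrt (∑ k : Fin (d 0), x ⟨0, k⟩ ^ 2)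

/-- The class `C₀^∞(G ∖ {x' = 0})` of complex-valued functions, extended by zero to `G`. -/
structure IsTestFunction (u : Space d → ℂ) : Prop where
  smooth : ContDiff ℝ ∞ u
  compact : HasCompactSupport u
  support : tsupport u ⊆ {x | horizontalNorm x ≠ 0}

end Carnot

end

/-! Write `ρ = |x'|`, `N = d 0`, and let `w = (|u|² + ε)^{p/2} - ε^{p/2}` be a smooth substitute for
`|u|^p`. Homogeneity under the dilations makes each `X_k` divergence free with constant
first-stratum part `∂/∂x'_k` (`X_apply_first`, `fderiv_X_apply_single`). Functions of `x'` are
therefore differentiated as in `ℝ^N`, and integrating by parts gives `∫ ρ^{-α} ∑ x'_k X_k w = -(N-α)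
∫ ρ^{-α} w` and `∫ ρ^{2-α} 𝓛w = -(N-α)(α-2) ∫ ρ^{-α} w`.

By the chain rule and Cauchy–Schwarz, `𝓛w` dominates `p (|u|²+ε)^{p/2-1} Re(ū 𝓛u)` plus a gradient
term. Completing a square with a free parameter `c` (`le_along_along_regPow`) bounds that term below
by the Euler derivative of `w` and a multiple of `ρ^{-2} (|u|²+ε)^{p/2}`, so no separate Hardy
inequality is needed. With `c = (N-α)/p` the coefficients add up to `p/C`. Young's inequality,
scaled by the same `C`, absorbs `(p-1)/C` of this and leaves `C^p`. Finally `ε → 0`. -/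

noncomputable section

namespace Carnot

open Filter Topology

/-! ### Homogeneity and vanishing divergence of the generators -/

section Group

variable {r : ℕ} {d : Fin r → ℕ}

/-- The dilation `δ_t` as a continuous linear map. -/
def dilationCLM (t : ℝ) : Space d →L[ℝ] Space d :=
  ContinuousLinearMap.pi fun i => t ^ ((i.1 : ℕ) + 1) • ContinuousLinearMap.proj i

theorem dilationCLM_single (t : ℝ) (i : Σ l : Fin r, Fin (d l)) (c : ℝ) :
    dilationCLM t (Pi.single i c : Space d) = t ^ ((i.1 : ℕ) + 1) • Pi.single i c := by
  ext j
  by_cases h : j = i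
  · subst h; simp [dilationCLM]
  · simp [dilationCLM, h]

theorem continuous_dilation (x : Space d) : Continuous fun t : ℝ => dilation t x := by
  unfold dilation
  fun_prop

theorem dilation_zero_left (x : Space d) : dilation 0 x = 0 := by
  ext i; simp [dilation]

namespace HomogeneousGroup

variable (G : HomogeneousGroup d)

theorem differentiable_mul_left (x : Space d) : Differentiable ℝ (G.mul x) :=
  (G.contDiff_mul.comp (contDiff_prodMk_right x)).differentiable (by simp)

variable [NeZero r] (k : Fin (d 0))

theorem contDiff_X : ContDiff ℝ ∞ (G.X k) := by
  have h : ContDiff ℝ ∞ fun x => fderiv ℝ (G.mul x) 0 :=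
    ContDiff.fderiv (f := G.mul) (m := ∞) G.contDiff_mul contDiff_const (by simp)
  exact h.clm_apply contDiff_const

/-- The vector field `X_k` is homogeneous of degree one with respect to the dilations. -/
theorem X_dilation_apply {t : ℝ} (ht : 0 < t) (x : Space d) (i : Σ l : Fin r, Fin (d l)) :
    G.X k (dilation t x) i = t ^ (i.1 : ℕ) * G.X k x i := by
  -- The automorphism identity is differentiated in `y` at `0`. The direction `∂/∂x'_k` is scaled by
  -- `t` on one side, which cancels one power of `t`.
  have h1 : (fun y => G.mul (dilation t x) (dilationCLM t y)) =
      fun y => dilationCLM t (G.mul x y) := by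
    ext1 y
    exact (G.dilation_mul t ht x y).symm
  have h2 : HasFDerivAt (fun y => G.mul (dilation t x) (dilationCLM t y))
      ((fderiv ℝ (G.mul (dilation t x)) 0).comp (dilationCLM t)) 0 := by
    have := (G.differentiable_mul_left (dilation t x) (dilationCLM t 0)).hasFDerivAt.comp 0
      (dilationCLM t).hasFDerivAt
    rwa [map_zero] at this
  have h3 : HasFDerivAt (fun y => dilationCLM t (G.mul x y))
      ((dilationCLM t).comp (fderiv ℝ (G.mul x) 0)) 0 :=
    (dilationCLM t).hasFDerivAt.comp 0 (G.differentiable_mul_left x 0).hasFDerivAt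
  rw [h1] at h2
  have h4 := congrFun (DFunLike.congr_fun (h2.unique h3) (Pi.single ⟨0, k⟩ 1)) i
  simp only [ContinuousLinearMap.comp_apply, dilationCLM_single, map_smul, Pi.smul_apply,
    smul_eq_mul, Fin.val_zero, zero_add, pow_one] at h4
  have h5 : t * G.X k (dilation t x) i = t ^ ((i.1 : ℕ) + 1) * G.X k x i := by
    simpa [dilationCLM, X] using h4
  have : t ≠ 0 := ht.ne'
  apply mul_left_cancel₀ this
  rw [h5]; ring

theorem X_zero : G.X k 0 = Pi.single ⟨0, k⟩ 1 := by
  have : (fun y => G.mul 0 y) = id := funext G.zero_mul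
  simp [X, this]

/-- The component of `X_k` in the first stratum is constant. -/
theorem X_apply_first (x : Space d) (j : Fin (d 0)) :
    G.X k x ⟨0, j⟩ = (Pi.single ⟨0, k⟩ 1 : Space d) ⟨0, j⟩ := by
  -- This component has degree `0`, so it is constant along `t ↦ δ_t x`; continuity at the origin
  -- identifies the constant.
  have h1 : Tendsto (fun t : ℝ => G.X k (dilation t x) ⟨0, j⟩) (𝓝[>] 0)
      (𝓝 (G.X k 0 ⟨0, j⟩)) := by
    have hc : Continuous fun t : ℝ => G.X k (dilation t x) ⟨0, j⟩ :=
      (continuous_apply _).comp ((G.contDiff_X k).continuous.comp (continuous_dilation x))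
    have := hc.tendsto 0
    rw [dilation_zero_left] at this
    exact this.mono_left nhdsWithin_le_nhds
  have h2 : Tendsto (fun t : ℝ => G.X k (dilation t x) ⟨0, j⟩) (𝓝[>] 0)
      (𝓝 (G.X k x ⟨0, j⟩)) := by
    refine tendsto_const_nhds.congr' ?_
    filter_upwards [self_mem_nhdsWithin] with t ht
    rw [G.X_dilation_apply k ht]
    simp
  rw [tendsto_nhds_unique h2 h1, X_zero]

theorem contDiff_X_apply (i : Σ l : Fin r, Fin (d l)) : ContDiff ℝ ∞ fun x => G.X k x i :=
  contDiff_pi.1 (G.contDiff_X k) i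

/-- Each summand of the divergence of `X_k` vanishes. -/
theorem fderiv_X_apply_single (x : Space d) (i : Σ l : Fin r, Fin (d l)) :
    fderiv ℝ (fun y => G.X k y i) x (Pi.single i 1) = 0 := by
  have hd : Differentiable ℝ fun y => G.X k y i := (G.contDiff_X_apply k i).differentiable (by simp)
  -- The `i`-th component has degree one less than the weight of the `i`-th coordinate, so this
  -- derivative has degree `-1`. Being continuous at the origin, it must vanish.
  have key : ∀ t : ℝ, 0 < t →
      t * fderiv ℝ (fun y => G.X k y i) (dilation t x) (Pi.single i 1) =
        fderiv ℝ (fun y => G.X k y i) x (Pi.single i 1) := by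
    intro t ht
    have h1 : HasFDerivAt (fun y => G.X k (dilationCLM t y) i)
        ((fderiv ℝ (fun y => G.X k y i) (dilation t x)).comp (dilationCLM t)) x :=
      (hd (dilationCLM t x)).hasFDerivAt.comp x (dilationCLM t).hasFDerivAt
    have h2 : HasFDerivAt (fun y => t ^ (i.1 : ℕ) * G.X k y i)
        (t ^ (i.1 : ℕ) • fderiv ℝ (fun y => G.X k y i) x) x :=
      (hd x).hasFDerivAt.const_mul _
    have h3 : (fun y => G.X k (dilationCLM t y) i) = fun y => t ^ (i.1 : ℕ) * G.X k y i :=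
      funext fun y => G.X_dilation_apply k ht y i
    rw [h3] at h1
    have h4 := DFunLike.congr_fun (h1.unique h2) (Pi.single i 1)
    rw [ContinuousLinearMap.comp_apply, dilationCLM_single, map_smul,
      smul_apply, smul_eq_mul, smul_eq_mul, pow_succ, _root_.mul_assoc] at h4
    exact mul_left_cancel₀ (pow_ne_zero _ ht.ne') h4
  have hc : Continuous fun t : ℝ =>
      t * fderiv ℝ (fun y => G.X k y i) (dilation t x) (Pi.single i 1) := by
    have h := ((G.contDiff_X_apply k i).continuous_fderiv (by simp)).comp (continuous_dilation x)
    exact continuous_id.mul (h.clm_apply continuous_const)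
  have h1 : Tendsto (fun t : ℝ =>
      t * fderiv ℝ (fun y => G.X k y i) (dilation t x) (Pi.single i 1)) (𝓝[>] 0) (𝓝 0) := by
    have := hc.tendsto 0
    rw [MulZeroClass.zero_mul] at this
    exact this.mono_left nhdsWithin_le_nhds
  refine tendsto_nhds_unique (tendsto_const_nhds.congr' ?_) h1
  filter_upwards [self_mem_nhdsWithin] with t ht
  exact (key t ht).symm

/-- The integral of a derivative along `X_k` vanishes, since `X_k` is divergence free. -/
theorem integral_fderiv_X {f : Space d → ℝ} (hf : ContDiff ℝ 1 f) (hc : HasCompactSupport f) :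
    ∫ x, fderiv ℝ f x (G.X k x) = 0 := by
  have hfd : Differentiable ℝ f := hf.differentiable (by simp)
  have hint : ∀ i, Integrable fun x => G.X k x i * fderiv ℝ f x (Pi.single i 1) := fun i =>
    (((G.contDiff_X_apply k i).continuous).mul
      ((hf.continuous_fderiv (by simp)).clm_apply continuous_const)).integrable_of_hasCompactSupport
      (HasCompactSupport.mul_left (hc.fderiv_apply ℝ _))
  have hsum : ∀ x, fderiv ℝ f x (G.X k x) =
      ∑ i, G.X k x i * fderiv ℝ f x (Pi.single i 1) := by
    intro x
    conv_lhs => rw [pi_eq_sum_univ' (G.X k x), map_sum]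
    refine Finset.sum_congr rfl fun i _ => ?_
    rw [map_smul, smul_eq_mul]
  simp_rw [hsum]
  rw [integral_finsetSum _ fun i _ => hint i]
  refine Finset.sum_eq_zero fun i _ => ?_
  rw [integral_mul_fderiv_eq_neg_fderiv_mul_of_integrable]
  · simp [fderiv_X_apply_single]
  · simp [fderiv_X_apply_single]
  · exact hint i
  · exact (((G.contDiff_X_apply k i).continuous).mul
      hf.continuous).integrable_of_hasCompactSupport hc.mul_left
  · exact fun x _ => (G.contDiff_X_apply k i).differentiable (by simp) x
  · exact fun x _ => hfd x

end HomogeneousGroup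

end Group

/-! ### Powers of `|x'|` and integration by parts -/

section Weights

variable {r : ℕ} {d : Fin r → ℕ} [NeZero r]

theorem horizontalNorm_nonneg (x : Space d) : 0 ≤ horizontalNorm x := Real.sqrt_nonneg _

theorem horizontalNorm_sq (x : Space d) :
    horizontalNorm x ^ 2 = ∑ k : Fin (d 0), x ⟨0, k⟩ ^ 2 :=
  Real.sq_sqrt (Finset.sum_nonneg fun _ _ => sq_nonneg _)

theorem horizontalNorm_pos {x : Space d} (hx : horizontalNorm x ≠ 0) : 0 < horizontalNorm x :=
  (horizontalNorm_nonneg x).lt_of_ne' hx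

theorem contDiffAt_horizontalNorm_rpow {x : Space d} (hx : horizontalNorm x ≠ 0) (β : ℝ) :
    ContDiffAt ℝ ∞ (fun y : Space d => horizontalNorm y ^ β) x := by
  refine ContDiffAt.rpow_const_of_ne (ContDiffAt.sqrt ?_ ?_) hx
  · fun_prop
  · intro h
    exact hx (by simp [horizontalNorm, h])

/-- Smooth functions with compact support away from `{x' = 0}`. -/
structure IsTest {E : Type*} [NormedAddCommGroup E] [NormedSpace ℝ E] (f : Space d → E) :
    Prop where
  smooth : ContDiff ℝ ∞ f
  compact : HasCompactSupport f
  support : tsupport f ⊆ {x | horizontalNorm x ≠ 0}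

theorem IsTestFunction.isTest {u : Space d → ℂ} (hu : IsTestFunction u) : IsTest u :=
  ⟨hu.smooth, hu.compact, hu.support⟩

section Test

variable {E : Type*} [NormedAddCommGroup E] [NormedSpace ℝ E]

theorem IsTest.eq_zero {f : Space d → E} (hf : IsTest f) {x : Space d}
    (hx : horizontalNorm x = 0) : f x = 0 :=
  image_eq_zero_of_notMem_tsupport fun h => hf.support h hx

theorem IsTest.of_tsupport_subset {F : Type*} [NormedAddCommGroup F] [NormedSpace ℝ F]
    {f : Space d → E} (hf : IsTest f) {g : Space d → F} (hg : ContDiff ℝ ∞ g)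
    (hs : tsupport g ⊆ tsupport f) : IsTest g :=
  ⟨hg, hf.compact.of_isClosed_subset (isClosed_tsupport g) hs, hs.trans hf.support⟩

/-- The product of a test function with a function smooth away from `{x' = 0}`. -/
theorem IsTest.mul_left {f h : Space d → ℝ} (hf : IsTest f)
    (hh : ∀ x, horizontalNorm x ≠ 0 → ContDiffAt ℝ ∞ h x) : IsTest fun x => h x * f x := by
  have hs : tsupport (fun x => h x * f x) ⊆ tsupport f := tsupport_mul_subset_right
  refine hf.of_tsupport_subset ?_ hs
  refine contDiff_iff_contDiffAt.2 fun x => ?_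
  by_cases hx : x ∈ tsupport f
  · exact (hh x (hf.support hx)).mul hf.smooth.contDiffAt
  · refine (contDiffAt_const (c := (0 : ℝ))).congr_of_eventuallyEq ?_
    exact notMem_tsupport_iff_eventuallyEq.1 fun h => hx (hs h)

/-- A continuous function with compact support away from `{x' = 0}` is integrable against powers
of `|x'|`. -/
theorem integrable_horizontalNorm_rpow_mul {f : Space d → ℝ} (hf : Continuous f)
    (hc : HasCompactSupport f) (hs : tsupport f ⊆ {x | horizontalNorm x ≠ 0}) (β : ℝ) :
    Integrable fun x => horizontalNorm x ^ β * f x := by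
  refine Continuous.integrable_of_hasCompactSupport ?_ hc.mul_left
  refine continuous_of_tsupport fun x hx => ?_
  have h : horizontalNorm x ≠ 0 := hs (tsupport_mul_subset_right hx)
  exact (contDiffAt_horizontalNorm_rpow h β).continuousAt.mul hf.continuousAt

theorem IsTest.integrable_rpow_mul {f : Space d → ℝ} (hf : IsTest f) (β : ℝ) :
    Integrable fun x => horizontalNorm x ^ β * f x :=
  integrable_horizontalNorm_rpow_mul hf.smooth.continuous hf.compact hf.support β

namespace HomogeneousGroup

variable (G : HomogeneousGroup d) (k : Fin (d 0))

/-- The derivative of a vector valued function along `X_k`. -/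
def along (f : Space d → E) (x : Space d) : E := fderiv ℝ f x (G.X k x)

theorem contDiff_along {f : Space d → E} (hf : ContDiff ℝ ∞ f) : ContDiff ℝ ∞ (G.along k f) :=
  (hf.fderiv_right (m := ∞) (by simp)).clm_apply (G.contDiff_X k)

theorem tsupport_along_subset (f : Space d → E) : tsupport (G.along k f) ⊆ tsupport f := by
  refine closure_minimal (fun x hx => ?_) (isClosed_tsupport f)
  refine support_fderiv_subset ℝ fun h => hx ?_
  simp [along, h]

variable {k} in
theorem _root_.Carnot.IsTest.along {f : Space d → E} (hf : IsTest f) : IsTest (G.along k f) :=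
  hf.of_tsupport_subset (G.contDiff_along k hf.smooth) (G.tsupport_along_subset k f)

theorem along_mul {f g : Space d → ℝ} {x : Space d} (hf : DifferentiableAt ℝ f x)
    (hg : DifferentiableAt ℝ g x) :
    G.along k (fun y => f y * g y) x = G.along k f x * g x + f x * G.along k g x := by
  simp only [along]
  rw [fderiv_fun_mul hf hg]
  simp
  ring

theorem along_coord (x : Space d) : G.along k (fun y => y ⟨0, k⟩) x = 1 := by
  have h : HasFDerivAt (fun y : Space d => y ⟨0, k⟩)
    (ContinuousLinearMap.proj (R := ℝ) (φ := fun _ => ℝ) ⟨0, k⟩) x :=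
    hasFDerivAt_apply _ _
  simp [along, h.fderiv, X_apply_first]

/-- Only the first-stratum part of `X_k` acts on a function of `x'`, so the Euclidean formula
persists. -/
theorem along_horizontalNorm_rpow {x : Space d} (hx : horizontalNorm x ≠ 0) (β : ℝ) :
    G.along k (fun y => horizontalNorm y ^ β) x =
      β * horizontalNorm x ^ (β - 2) * x ⟨0, k⟩ := by
  have hpos := horizontalNorm_pos hx
  have h1 : HasFDerivAt (fun y : Space d => ∑ j : Fin (d 0), y ⟨0, j⟩ ^ 2)
      (∑ j : Fin (d 0), (2 * x ⟨0, j⟩) •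
        ContinuousLinearMap.proj (R := ℝ) (φ := fun _ : (Σ l : Fin r, Fin (d l)) => ℝ)
          ⟨0, j⟩) x := by
    refine HasFDerivAt.fun_sum fun j _ => ?_
    simpa using (hasFDerivAt_apply (𝕜 := ℝ) (⟨0, j⟩ : Σ l : Fin r, Fin (d l)) x).pow 2
  have h0 : ∑ j : Fin (d 0), x ⟨0, j⟩ ^ 2 ≠ 0 := by
    rw [← horizontalNorm_sq]; exact pow_ne_zero _ hx
  have h2 : HasFDerivAt (fun y : Space d => horizontalNorm y ^ β) _ x :=
    (h1.sqrt h0).rpow_const (p := β) (Or.inl (by exact hx))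
  have h3 : ∑ j : Fin (d 0), x ⟨0, j⟩ * G.X k x ⟨0, j⟩ = x ⟨0, k⟩ := by
    rw [Finset.sum_eq_single k]
    · simp [X_apply_first]
    · intro j _ hj
      simp [X_apply_first, hj]
    · simp
  have h4 : Real.sqrt (∑ j : Fin (d 0), x ⟨0, j⟩ ^ 2) = horizontalNorm x := rfl
  rw [along, h2.fderiv]
  simp only [smul_apply, sum_apply,
    ContinuousLinearMap.proj_apply, smul_eq_mul, h4, _root_.mul_assoc (2 : ℝ), ← Finset.mul_sum, h3]
  have h5 : β - 1 = (β - 2) + 1 := by ring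
  rw [h5, Real.rpow_add_one hx]
  field_simp

/-- The divergence theorem for a horizontal field whose components are products. -/
theorem integral_sum_along_mul {h f : Fin (d 0) → Space d → ℝ}
    (hh : ∀ k x, horizontalNorm x ≠ 0 → ContDiffAt ℝ ∞ (h k) x) (hf : ∀ k, IsTest (f k)) :
    ∫ x, ∑ k, (G.along k (h k) x * f k x + h k x * G.along k (f k) x) = 0 := by
  have hF : ∀ k, IsTest fun x => h k x * f k x := fun k => (hf k).mul_left (hh k)
  have heq : ∀ x, ∑ k, (G.along k (h k) x * f k x + h k x * G.along k (f k) x) =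
      ∑ k, G.along k (fun y => h k y * f k y) x := by
    intro x
    refine Finset.sum_congr rfl fun k _ => ?_
    -- On `{x' = 0}` the weight need not be differentiable, but the test function and its
    -- derivatives vanish there.
    by_cases hx : horizontalNorm x = 0
    · rw [(hf k).eq_zero hx, ((hf k).along G).eq_zero hx, ((hF k).along G).eq_zero hx]
      simp
    · rw [G.along_mul k ((hh k x hx).differentiableAt (by simp))
        ((hf k).smooth.differentiable (by simp) x)]
  simp_rw [heq]
  rw [integral_finsetSum _ fun k _ => ((hF k).along G).smooth.continuous.integrable_of_hasCompactSupport
    ((hF k).along G).compact]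
  exact Finset.sum_eq_zero fun k _ =>
    G.integral_fderiv_X k ((hF k).smooth.of_le (by simp)) (hF k).compact

/-- Integration by parts against the horizontal Euler field. -/
theorem integral_horizontal_euler {w : Space d → ℝ} (hw : IsTest w) (α : ℝ) :
    ∫ x, horizontalNorm x ^ (-α) * ∑ k, x ⟨0, k⟩ * G.along k w x =
      -(((d 0 : ℝ) - α) * ∫ x, horizontalNorm x ^ (-α) * w x) := by
  have hcoord : ∀ k, ContDiff ℝ ∞ fun y : Space d => y ⟨0, k⟩ := fun k => contDiff_apply _ _ _
  have h0 := G.integral_sum_along_mul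
    (h := fun k x => horizontalNorm x ^ (-α) * x ⟨0, k⟩) (f := fun _ => w)
    (fun k x hx => (contDiffAt_horizontalNorm_rpow hx (-α)).mul (hcoord k).contDiffAt)
    (fun _ => hw)
  have heq : ∀ x, ∑ k, (G.along k (fun x => horizontalNorm x ^ (-α) * x ⟨0, k⟩) x * w x +
        horizontalNorm x ^ (-α) * x ⟨0, k⟩ * G.along k w x) =
      ((d 0 : ℝ) - α) * (horizontalNorm x ^ (-α) * w x) +
        horizontalNorm x ^ (-α) * ∑ k, x ⟨0, k⟩ * G.along k w x := by
    intro x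
    rw [Finset.sum_add_distrib, Finset.mul_sum]
    congr 1
    · by_cases hx : horizontalNorm x = 0
      · simp [hw.eq_zero hx]
      · have h1 : ∀ k, G.along k (fun x => horizontalNorm x ^ (-α) * x ⟨0, k⟩) x * w x =
            (-α * horizontalNorm x ^ (-α - 2) * w x) * x ⟨0, k⟩ ^ 2 +
              horizontalNorm x ^ (-α) * w x := by
          intro k
          rw [G.along_mul k ((contDiffAt_horizontalNorm_rpow hx (-α)).differentiableAt (by simp))
            ((hcoord k).differentiable (by simp) x), along_coord,
            along_horizontalNorm_rpow G k hx]
          ring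
        simp_rw [h1]
        rw [Finset.sum_add_distrib, ← Finset.mul_sum, ← horizontalNorm_sq]
        have h2 : horizontalNorm x ^ (-α) = horizontalNorm x ^ (-α - 2) * horizontalNorm x ^ 2 := by
          rw [← Real.rpow_natCast, ← Real.rpow_add (horizontalNorm_pos hx)]
          norm_num
        simp only [Finset.sum_const, Finset.card_univ, Fintype.card_fin, nsmul_eq_mul]
        rw [h2]
        ring
    · exact Finset.sum_congr rfl fun k _ => by ring
  have hint : Integrable fun x => horizontalNorm x ^ (-α) * ∑ k, x ⟨0, k⟩ * G.along k w x := by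
    simp_rw [Finset.mul_sum]
    exact integrable_finsetSum _ fun k _ =>
      ((hw.along G).mul_left fun x _ => (hcoord k).contDiffAt).integrable_rpow_mul (-α)
  simp_rw [heq] at h0
  rw [integral_add ((hw.integrable_rpow_mul (-α)).const_mul _) hint, integral_const_mul] at h0
  linarith

/-- Integration by parts of the sub-Laplacian against a power of `|x'|`. -/
theorem integral_rpow_mul_along_along {w : Space d → ℝ} (hw : IsTest w) (α : ℝ) :
    ∫ x, horizontalNorm x ^ (2 - α) * ∑ k, G.along k (G.along k w) x =
      -(((d 0 : ℝ) - α) * (α - 2) * ∫ x, horizontalNorm x ^ (-α) * w x) := by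
  have h0 := G.integral_sum_along_mul
    (h := fun _ x => horizontalNorm x ^ (2 - α)) (f := fun k => G.along k w)
    (fun k x hx => contDiffAt_horizontalNorm_rpow hx (2 - α))
    (fun _ => hw.along G)
  have heq : ∀ x, ∑ k, (G.along k (fun x => horizontalNorm x ^ (2 - α)) x * G.along k w x +
        horizontalNorm x ^ (2 - α) * G.along k (G.along k w) x) =
      (2 - α) * (horizontalNorm x ^ (-α) * ∑ k, x ⟨0, k⟩ * G.along k w x) +
        horizontalNorm x ^ (2 - α) * ∑ k, G.along k (G.along k w) x := by
    intro x
    rw [Finset.sum_add_distrib, Finset.mul_sum, Finset.mul_sum, Finset.mul_sum]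
    congr 1
    refine Finset.sum_congr rfl fun k _ => ?_
    by_cases hx : horizontalNorm x = 0
    · simp [(hw.along G).eq_zero hx]
    · rw [along_horizontalNorm_rpow G k hx]
      have : 2 - α - 2 = -α := by ring
      rw [this]; ring
  have hint1 : Integrable fun x => horizontalNorm x ^ (-α) * ∑ k, x ⟨0, k⟩ * G.along k w x := by
    simp_rw [Finset.mul_sum]
    exact integrable_finsetSum _ fun k _ =>
      ((hw.along G).mul_left fun x _ => (contDiff_apply _ _ _).contDiffAt).integrable_rpow_mul (-α)
  have hint2 : Integrable fun x =>
      horizontalNorm x ^ (2 - α) * ∑ k, G.along k (G.along k w) x := by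
    simp_rw [Finset.mul_sum]
    exact integrable_finsetSum _ fun k _ => ((hw.along G).along G).integrable_rpow_mul (2 - α)
  simp_rw [heq] at h0
  rw [integral_add (hint1.const_mul _) hint2, integral_const_mul,
    G.integral_horizontal_euler hw] at h0
  linarith

end HomogeneousGroup

end Test

end Weights

/-! ### Pointwise bounds for the regularized power -/

section Regularization

variable {r : ℕ} {d : Fin r → ℕ}

/-- The smooth regularization `(|u|² + ε)^{p/2} - ε^{p/2}` of `|u|^p`. -/
def regPow (u : Space d → ℂ) (p ε : ℝ) (x : Space d) : ℝ :=
  (‖u x‖ ^ 2 + ε) ^ (p / 2) - ε ^ (p / 2)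

theorem contDiff_normSq_add_rpow {u : Space d → ℂ} (hu : ContDiff ℝ ∞ u) {ε : ℝ} (hε : 0 < ε)
    (q : ℝ) : ContDiff ℝ ∞ fun x => (‖u x‖ ^ 2 + ε) ^ q :=
  ((hu.norm_sq ℝ).add contDiff_const).rpow_const_of_ne fun x => by positivity

theorem tsupport_regPow_subset (u : Space d → ℂ) (p ε : ℝ) :
    tsupport (regPow u p ε) ⊆ tsupport u :=
  closure_mono fun x hx h => hx (by simp [regPow, h])

variable [NeZero r]

theorem IsTest.regPow {u : Space d → ℂ} (hu : IsTest u) (p : ℝ) {ε : ℝ} (hε : 0 < ε) :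
    IsTest (regPow u p ε) :=
  hu.of_tsupport_subset ((contDiff_normSq_add_rpow hu.smooth hε _).sub contDiff_const)
    (tsupport_regPow_subset u p ε)

namespace HomogeneousGroup

variable (G : HomogeneousGroup d) (k : Fin (d 0))

theorem along_normSq_add_rpow {u : Space d → ℂ} (hu : ContDiff ℝ ∞ u) {ε : ℝ} (hε : 0 < ε)
    (q : ℝ) (x : Space d) :
    G.along k (fun y => (‖u y‖ ^ 2 + ε) ^ q) x =
      2 * q * (‖u x‖ ^ 2 + ε) ^ (q - 1) * inner ℝ (u x) (G.along k u x) := by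
  have h1 : HasFDerivAt u (fderiv ℝ u x) x := (hu.differentiable (by simp) x).hasFDerivAt
  have h2 := (h1.norm_sq.add_const ε).rpow_const (p := q) (Or.inl (by positivity))
  rw [along, h2.fderiv]
  simp [along]
  ring

theorem along_regPow {u : Space d → ℂ} (hu : ContDiff ℝ ∞ u) (p : ℝ) {ε : ℝ} (hε : 0 < ε)
    (x : Space d) :
    G.along k (regPow u p ε) x =
      p * (‖u x‖ ^ 2 + ε) ^ (p / 2 - 1) * inner ℝ (u x) (G.along k u x) := by
  have h := G.along_normSq_add_rpow k hu hε (p / 2) x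
  have h2 : 2 * (p / 2) = p := by ring
  rw [h2] at h
  rw [← h]
  unfold along regPow
  rw [fderiv_sub_const]

theorem along_along_regPow {u : Space d → ℂ} (hu : ContDiff ℝ ∞ u) (p : ℝ) {ε : ℝ} (hε : 0 < ε)
    (x : Space d) :
    G.along k (G.along k (regPow u p ε)) x =
      p * (‖u x‖ ^ 2 + ε) ^ (p / 2 - 1) *
          (‖G.along k u x‖ ^ 2 + inner ℝ (u x) (G.along k (G.along k u) x)) +
        p * (p - 2) * (‖u x‖ ^ 2 + ε) ^ (p / 2 - 2) * inner ℝ (u x) (G.along k u x) ^ 2 := by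
  have h1 : G.along k (regPow u p ε) = fun y => (‖u y‖ ^ 2 + ε) ^ (p / 2 - 1) *
      (p * inner ℝ (u y) (G.along k u y)) := by
    ext y; rw [G.along_regPow k hu p hε]; ring
  have hXu := G.contDiff_along k hu
  have h2 : ContDiff ℝ ∞ fun y => inner ℝ (u y) (G.along k u y) := hu.inner ℝ hXu
  have h3 : G.along k (fun y => p * inner ℝ (u y) (G.along k u y)) x =
      p * (‖G.along k u x‖ ^ 2 + inner ℝ (u x) (G.along k (G.along k u) x)) := by
    rw [along, fderiv_const_mul (h2.differentiable (by simp) x), smul_apply,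
      fderiv_inner_apply ℝ (hu.differentiable (by simp) x) (hXu.differentiable (by simp) x)]
    change p * (inner ℝ (u x) (G.along k (G.along k u) x) +
      inner ℝ (G.along k u x) (G.along k u x)) = _
    rw [real_inner_self_eq_norm_sq]
    ring
  rw [h1, G.along_mul k
    ((contDiff_normSq_add_rpow hu hε _).differentiable (by simp) x)
    ((contDiff_const.mul h2).differentiable (by simp) x), h3,
    G.along_normSq_add_rpow k hu hε]
  have h4 : p / 2 - 1 - 1 = p / 2 - 2 := by ring
  rw [h4]
  ring

/-- The first-order terms of `X_k² w` split into a Cauchy–Schwarz defect and `p(p-1)` times a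
square. The latter is bounded below by its tangent line; at `ε = 0` the bound is sharp for the model
profile `u = |x'|^{-c}`. -/
theorem le_along_along_regPow {u : Space d → ℂ} (hu : ContDiff ℝ ∞ u) {p : ℝ} (hp : 1 ≤ p)
    {ε : ℝ} (hε : 0 < ε) (c : ℝ) {x : Space d} (hx : horizontalNorm x ≠ 0) :
    p * (‖u x‖ ^ 2 + ε) ^ (p / 2 - 1) * inner ℝ (u x) (G.along k (G.along k u) x) -
        2 * c * (p - 1) / horizontalNorm x ^ 2 * (x ⟨0, k⟩ * G.along k (regPow u p ε) x) -
        p * (p - 1) * c ^ 2 * (‖u x‖ ^ 2 + ε) ^ (p / 2) / horizontalNorm x ^ 4 * x ⟨0, k⟩ ^ 2 ≤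
      G.along k (G.along k (regPow u p ε)) x := by
  rw [G.along_along_regPow k hu p hε, G.along_regPow k hu p hε]
  set m := ‖u x‖ ^ 2 + ε with hm
  have hmpos : 0 < m := by positivity
  set a : ℝ := inner ℝ (u x) (G.along k u x) with ha
  set n := ‖G.along k u x‖
  set ρ := horizontalNorm x
  have hcs : a ^ 2 ≤ m * n ^ 2 := by
    have h1 : |a| ≤ ‖u x‖ * n := abs_real_inner_le_norm _ _
    have h2 : a ^ 2 ≤ (‖u x‖ * n) ^ 2 := sq_le_sq' (by linarith [neg_abs_le a]) (by
      linarith [le_abs_self a])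
    nlinarith [mul_nonneg hε.le (sq_nonneg n)]
  have e1 : m ^ (p / 2 - 1) = m ^ (p / 2 - 2) * m := by
    rw [← Real.rpow_add_one hmpos.ne']; congr 1; ring
  have e2 : m ^ (p / 2) = m ^ (p / 2 - 2) * m ^ 2 := by
    rw [← Real.rpow_natCast m 2, ← Real.rpow_add hmpos]; congr 1; norm_num
  have hq : 0 < m ^ (p / 2 - 2) := Real.rpow_pos_of_pos hmpos _
  rw [e1, e2]
  set q := m ^ (p / 2 - 2)
  have h3 : 0 ≤ p * q * (m * n ^ 2 - a ^ 2) :=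
    mul_nonneg (mul_nonneg (by linarith) hq.le) (by linarith)
  -- Its cross term is a multiple of `x'_k X_k w`, which can be integrated by parts after summing
  -- over `k`.
  have h4 : 0 ≤ p * (p - 1) * q * (a + c * x ⟨0, k⟩ * m / ρ ^ 2) ^ 2 :=
    mul_nonneg (mul_nonneg (mul_nonneg (by linarith) (by linarith)) hq.le) (sq_nonneg _)
  have h5 : p * (p - 1) * q * (a + c * x ⟨0, k⟩ * m / ρ ^ 2) ^ 2 =
      p * (p - 1) * q * a ^ 2 + 2 * c * (p - 1) / ρ ^ 2 * (x ⟨0, k⟩ * (p * (q * m) * a)) +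
        p * (p - 1) * c ^ 2 * (q * m ^ 2) / ρ ^ 4 * x ⟨0, k⟩ ^ 2 := by
    field_simp
    ring
  nlinarith [h3, h4, h5]

theorem le_sum_along_along_regPow {u : Space d → ℂ} (hu : ContDiff ℝ ∞ u) {p : ℝ} (hp : 1 ≤ p)
    {ε : ℝ} (hε : 0 < ε) (c : ℝ) {x : Space d} (hx : horizontalNorm x ≠ 0) :
    -(p * (‖u x‖ ^ 2 + ε) ^ ((p - 1) / 2) * ‖∑ k, G.along k (G.along k u) x‖) -
        2 * c * (p - 1) / horizontalNorm x ^ 2 * ∑ k, x ⟨0, k⟩ * G.along k (regPow u p ε) x -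
        p * (p - 1) * c ^ 2 * (‖u x‖ ^ 2 + ε) ^ (p / 2) / horizontalNorm x ^ 2 ≤
      ∑ k, G.along k (G.along k (regPow u p ε)) x := by
  have h := Finset.sum_le_sum fun k (_ : k ∈ Finset.univ) =>
    G.le_along_along_regPow k hu hp hε c hx
  rw [Finset.sum_sub_distrib, Finset.sum_sub_distrib, ← Finset.mul_sum, ← Finset.mul_sum,
    ← Finset.mul_sum, ← inner_sum, ← horizontalNorm_sq] at h
  set m := ‖u x‖ ^ 2 + ε with hm
  have hmpos : 0 < m := by positivity
  set L := ∑ k, G.along k (G.along k u) x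
  have h1 : -(m ^ ((1 : ℝ) / 2) * ‖L‖) ≤ inner ℝ (u x) L := by
    have h2 : |inner ℝ (u x) L| ≤ ‖u x‖ * ‖L‖ := abs_real_inner_le_norm _ _
    have h3 : ‖u x‖ ≤ m ^ ((1 : ℝ) / 2) := by
      rw [← Real.sqrt_eq_rpow]
      exact Real.le_sqrt_of_sq_le (by linarith)
    have h4 := mul_le_mul_of_nonneg_right h3 (norm_nonneg L)
    linarith [neg_abs_le (inner ℝ (u x) L)]
  have h5 : m ^ ((p - 1) / 2) = m ^ (p / 2 - 1) * m ^ ((1 : ℝ) / 2) := by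
    rw [← Real.rpow_add hmpos]; congr 1; ring
  have h6 : 0 ≤ p * m ^ (p / 2 - 1) := mul_nonneg (by linarith) (Real.rpow_nonneg hmpos.le _)
  have h7 := mul_le_mul_of_nonneg_left h1 h6
  have h8 : p * (p - 1) * c ^ 2 * m ^ (p / 2) / horizontalNorm x ^ 4 * horizontalNorm x ^ 2 =
      p * (p - 1) * c ^ 2 * m ^ (p / 2) / horizontalNorm x ^ 2 := by
    field_simp
  rw [h8] at h
  rw [h5]
  linarith

end HomogeneousGroup

/-- Young's inequality in the form used for `|u|^{p-1} |𝓛u|`. -/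
theorem young_rpow {p m z : ℝ} (hp : 1 ≤ p) (hm : 0 ≤ m) (hz : 0 ≤ z) :
    m ^ ((p - 1) / 2) * z ≤ (p - 1) / p * m ^ (p / 2) + z ^ p / p := by
  have hp0 : 0 < p := by linarith
  have h := Real.geom_mean_le_arith_mean2_weighted (w₁ := (p - 1) / p) (w₂ := 1 / p)
    (p₁ := m ^ (p / 2)) (p₂ := z ^ p) (div_nonneg (by linarith) hp0.le) (by positivity)
    (by positivity) (by positivity) (by field_simp; ring)
  rw [← Real.rpow_mul hm, ← Real.rpow_mul hz] at h
  have e1 : p / 2 * ((p - 1) / p) = (p - 1) / 2 := by field_simp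
  have e2 : p * (1 / p) = 1 := by field_simp
  rw [e1, e2, Real.rpow_one] at h
  calc _ ≤ _ := h
    _ = _ := by ring

namespace HomogeneousGroup

variable (G : HomogeneousGroup d)

/-- The left side collects exactly the terms whose integrals are multiples of `∫ ρ^{-α} w`. -/
theorem neg_weighted_le {u : Space d → ℂ} (hu : ContDiff ℝ ∞ u) {p : ℝ} (hp : 1 ≤ p)
    {ε : ℝ} (hε : 0 < ε) (c α : ℝ) {C : ℝ} (hC : 0 < C) {x : Space d}
    (hx : horizontalNorm x ≠ 0) :
    -(horizontalNorm x ^ (2 - α) * ∑ k, G.along k (G.along k (regPow u p ε)) x +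
        2 * c * (p - 1) * (horizontalNorm x ^ (-α) *
          ∑ k, x ⟨0, k⟩ * G.along k (regPow u p ε) x)) ≤
      (p * (p - 1) * c ^ 2 + (p - 1) / C) *
          (horizontalNorm x ^ (-α) * (‖u x‖ ^ 2 + ε) ^ (p / 2)) +
        C ^ p / C * (horizontalNorm x ^ (-(α - 2 * p)) *
          ‖∑ k, G.along k (G.along k u) x‖ ^ p) := by
  have h := G.le_sum_along_along_regPow hu hp hε c hx
  set m := ‖u x‖ ^ 2 + ε with hm
  have hmpos : 0 < m := by positivity
  set L := ∑ k, G.along k (G.along k u) x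
  have hρ := horizontalNorm_pos hx
  set ρ := horizontalNorm x
  have e1 : ρ ^ (2 - α) = ρ ^ (-α) * ρ ^ 2 := by
    rw [← Real.rpow_natCast ρ 2, ← Real.rpow_add hρ]; congr 1; push_cast; ring
  have e2 : ρ ^ (-(α - 2 * p)) = ρ ^ (-α) * (ρ ^ 2) ^ p := by
    rw [← Real.rpow_natCast ρ 2, ← Real.rpow_mul hρ.le, ← Real.rpow_add hρ]
    congr 1; push_cast; ring
  -- The factor `ρ²` makes both Young terms carry the weights of the theorem; the factor `C`
  -- balances their constants.
  have hy := young_rpow hp hmpos.le (z := C * ρ ^ 2 * ‖L‖) (by positivity)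
  rw [Real.mul_rpow (by positivity) (norm_nonneg L), Real.mul_rpow hC.le (by positivity)] at hy
  have hw : 0 < ρ ^ (-α) := Real.rpow_pos_of_pos hρ _
  rw [e1, e2]
  set W := ρ ^ (-α)
  have hp0 : 0 < p := by linarith
  have h1 := mul_le_mul_of_nonneg_left h (mul_nonneg hw.le (sq_nonneg ρ))
  have h2 := mul_le_mul_of_nonneg_left hy (mul_nonneg hw.le (div_nonneg hp0.le hC.le))
  set S := ∑ k, x ⟨0, k⟩ * G.along k (regPow u p ε) x
  set T := ∑ k, G.along k (G.along k (regPow u p ε)) x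
  have e3 : W * ρ ^ 2 * (-(p * m ^ ((p - 1) / 2) * ‖L‖) - 2 * c * (p - 1) / ρ ^ 2 * S -
      p * (p - 1) * c ^ 2 * m ^ (p / 2) / ρ ^ 2) =
      -(W * ρ ^ 2 * p * m ^ ((p - 1) / 2) * ‖L‖) - 2 * c * (p - 1) * (W * S) -
        p * (p - 1) * c ^ 2 * (W * m ^ (p / 2)) := by
    field_simp
  have e4 : W * (p / C) * (m ^ ((p - 1) / 2) * (C * ρ ^ 2 * ‖L‖)) =
      W * ρ ^ 2 * p * m ^ ((p - 1) / 2) * ‖L‖ := by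
    field_simp
  have e5 : W * (p / C) * ((p - 1) / p * m ^ (p / 2) + C ^ p * (ρ ^ 2) ^ p * ‖L‖ ^ p / p) =
      (p - 1) / C * (W * m ^ (p / 2)) + C ^ p / C * (W * (ρ ^ 2) ^ p * ‖L‖ ^ p) := by
    field_simp
  rw [e3] at h1
  rw [e4, e5] at h2
  linarith

end HomogeneousGroup

end Regularization

/-! ### The integrated inequality and the limit `ε → 0` -/

section Rellich

variable {r : ℕ} {d : Fin r → ℕ} [NeZero r]

theorem IsTest.integrable_rpow_mul_norm_rpow {f : Space d → ℂ} (hf : IsTest f) {p : ℝ}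
    (hp : 0 < p) (β : ℝ) : Integrable fun x => horizontalNorm x ^ β * ‖f x‖ ^ p := by
  have hs : tsupport (fun x => ‖f x‖ ^ p) ⊆ tsupport f :=
    closure_mono fun x hx h => hx (by simp [h, Real.zero_rpow hp.ne'])
  exact integrable_horizontalNorm_rpow_mul
    (hf.smooth.continuous.norm.rpow_const fun _ => Or.inr hp.le)
    (hf.compact.of_isClosed_subset (isClosed_tsupport _) hs) (hs.trans hf.support) β

/-- Replacing `(|u|²+ε)^{p/2}` by `w + ε^{p/2}` only on the support of `u` keeps the error
integrable. -/
theorem IsTest.integrable_indicator {f : Space d → ℂ} (hf : IsTest f) (β : ℝ) :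
    Integrable ((tsupport f).indicator fun x => horizontalNorm x ^ β) := by
  rw [integrable_indicator_iff (isClosed_tsupport f).measurableSet]
  refine ContinuousOn.integrableOn_compact hf.compact fun x hx => ?_
  exact (contDiffAt_horizontalNorm_rpow (hf.support hx) β).continuousAt.continuousWithinAt

namespace HomogeneousGroup

variable (G : HomogeneousGroup d)

theorem _root_.Carnot.IsTest.sum_along_along {f : Space d → ℂ} (hf : IsTest f) :
    IsTest fun x => ∑ k, G.along k (G.along k f) x := by
  refine hf.of_tsupport_subset
    (ContDiff.sum fun k _ => ((hf.along G).along G).smooth) ?_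
  refine closure_minimal (fun x hx => ?_) (isClosed_tsupport f)
  by_contra h
  refine hx (Finset.sum_eq_zero fun k _ => image_eq_zero_of_notMem_tsupport fun h' => h ?_)
  exact G.tsupport_along_subset k _ (G.tsupport_along_subset k _ h')

/-- The weighted Rellich inequality up to an error from the regularization. -/
theorem integral_rpow_mul_norm_rpow_le_add {u : Space d → ℂ} (hu : IsTest u) {p α : ℝ}
    (hp : 1 ≤ p) (hα : 2 < α) (hαN : α < d 0) {C : ℝ}
    (hC : C = p ^ 2 / (((d 0 : ℝ) - α) * ((p - 1) * (d 0 : ℝ) + α - 2 * p)))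
    {ε : ℝ} (hε : 0 < ε) :
    ∫ x, horizontalNorm x ^ (-α) * ‖u x‖ ^ p ≤
      C ^ p * (∫ x, horizontalNorm x ^ (-(α - 2 * p)) * ‖∑ k, G.along k (G.along k u) x‖ ^ p) +
        (C * (p * (p - 1) * (((d 0 : ℝ) - α) / p) ^ 2 + (p - 1) / C) + 1) *
          (∫ x, (tsupport u).indicator (fun x => horizontalNorm x ^ (-α)) x) * ε ^ (p / 2) := by
  have hp0 : 0 < p := by linarith
  have hN : 0 < (d 0 : ℝ) - α := by linarith
  -- The quantity equals `(p-1)(N-2) + (α-2)`.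
  have hD : 0 < (p - 1) * (d 0 : ℝ) + α - 2 * p := by nlinarith
  have hCpos : 0 < C := by rw [hC]; positivity
  have hw : IsTest (regPow u p ε) := hu.regPow p hε
  -- For `p > 1` this value maximizes `2c(p-1)(N-α) - p(p-1)c²`, the gain from the completed square.
  set c := ((d 0 : ℝ) - α) / p with hc
  set Q := p * (p - 1) * c ^ 2 + (p - 1) / C with hQ
  set w := regPow u p ε with hwdef
  set I := (tsupport u).indicator fun x => horizontalNorm x ^ (-α) with hI
  set L := fun x => ∑ k, G.along k (G.along k u) x with hL
  have hIint : Integrable I := hu.integrable_indicator _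
  have hJint := hw.integrable_rpow_mul (-α)
  have hAint := hu.integrable_rpow_mul_norm_rpow hp0 (-α)
  have hBint := (hu.sum_along_along G).integrable_rpow_mul_norm_rpow hp0 (-(α - 2 * p))
  have hEint : Integrable fun x => horizontalNorm x ^ (-α) * ∑ k, x ⟨0, k⟩ * G.along k w x := by
    simp_rw [Finset.mul_sum]
    exact integrable_finsetSum _ fun k _ =>
      ((hw.along G).mul_left fun x _ => (contDiff_apply _ _ _).contDiffAt).integrable_rpow_mul (-α)
  have hTint : Integrable fun x =>
      horizontalNorm x ^ (2 - α) * ∑ k, G.along k (G.along k w) x := by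
    simp_rw [Finset.mul_sum]
    exact integrable_finsetSum _ fun k _ => ((hw.along G).along G).integrable_rpow_mul (2 - α)
  have hwzero : ∀ x ∉ tsupport u, x ∉ tsupport w := fun x hx h =>
    hx (tsupport_regPow_subset u p ε h)
  have hpt : ∀ x, -(horizontalNorm x ^ (2 - α) * ∑ k, G.along k (G.along k w) x +
        2 * c * (p - 1) * (horizontalNorm x ^ (-α) * ∑ k, x ⟨0, k⟩ * G.along k w x)) ≤
      Q * (horizontalNorm x ^ (-α) * w x + ε ^ (p / 2) * I x) +
        C ^ p / C * (horizontalNorm x ^ (-(α - 2 * p)) * ‖L x‖ ^ p) := by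
    intro x
    by_cases hx : x ∈ tsupport u
    · have h := G.neg_weighted_le hu.smooth hp hε c α hCpos (hu.support hx)
      refine h.trans_eq ?_
      rw [hI, Set.indicator_of_mem hx, hwdef, regPow]
      ring
    · have h1 := hwzero x hx
      have h2 : ∀ k, G.along k w x = 0 := fun k =>
        image_eq_zero_of_notMem_tsupport fun h => h1 (G.tsupport_along_subset k _ h)
      have h3 : ∀ k, G.along k (G.along k w) x = 0 := fun k =>
        image_eq_zero_of_notMem_tsupport fun h =>
          h1 (G.tsupport_along_subset k _ (G.tsupport_along_subset k _ h))
      have h4 : 0 ≤ C ^ p / C * (horizontalNorm x ^ (-(α - 2 * p)) * ‖L x‖ ^ p) := by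
        have := horizontalNorm_nonneg x
        positivity
      rw [hI, Set.indicator_of_notMem hx, image_eq_zero_of_notMem_tsupport h1]
      simpa [h2, h3] using h4
  have hJIint : Integrable fun x => horizontalNorm x ^ (-α) * w x + ε ^ (p / 2) * I x :=
    hJint.add (hIint.const_mul _)
  have hmono := integral_mono (hTint.add (hEint.const_mul (2 * c * (p - 1)))).neg
    ((hJIint.const_mul Q).add (hBint.const_mul (C ^ p / C))) hpt
  simp only [Pi.neg_apply, Pi.add_apply] at hmono
  rw [integral_neg, integral_add hTint (hEint.const_mul _), integral_const_mul,
    integral_add (hJIint.const_mul Q) (hBint.const_mul (C ^ p / C)), integral_const_mul,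
    integral_const_mul,
    integral_add hJint (hIint.const_mul _), integral_const_mul,
    G.integral_horizontal_euler hw, G.integral_rpow_mul_along_along hw] at hmono
  have hA : ∫ x, horizontalNorm x ^ (-α) * ‖u x‖ ^ p ≤
      (∫ x, horizontalNorm x ^ (-α) * w x) + ε ^ (p / 2) * ∫ x, I x := by
    rw [← integral_const_mul, ← integral_add hJint (hIint.const_mul _)]
    refine integral_mono hAint (hJint.add (hIint.const_mul _)) fun x => ?_
    beta_reduce
    by_cases hx : x ∈ tsupport u
    · rw [hI, Set.indicator_of_mem hx, hwdef, regPow]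
      have h1 : ‖u x‖ ^ p ≤ (‖u x‖ ^ 2 + ε) ^ (p / 2) := by
        have : ‖u x‖ ^ p = (‖u x‖ ^ 2) ^ (p / 2) := by
          rw [← Real.rpow_natCast, ← Real.rpow_mul (norm_nonneg _)]
          congr 1; push_cast; ring
        rw [this]
        exact Real.rpow_le_rpow (sq_nonneg _) (by linarith) (by linarith)
      have h2 := mul_le_mul_of_nonneg_left h1
        (Real.rpow_nonneg (horizontalNorm_nonneg x) (-α))
      linarith
    · rw [hI, Set.indicator_of_notMem hx, image_eq_zero_of_notMem_tsupport (hwzero x hx),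
        image_eq_zero_of_notMem_tsupport hx]
      simp [Real.zero_rpow hp0.ne']
  set J := ∫ x, horizontalNorm x ^ (-α) * w x
  set A := ∫ x, horizontalNorm x ^ (-α) * ‖u x‖ ^ p
  set B := ∫ x, horizontalNorm x ^ (-(α - 2 * p)) * ‖L x‖ ^ p
  set M := ∫ x, I x
  -- The explicit constant of the theorem comes from this identity.
  have hid : ((d 0 : ℝ) - α) * (α - 2) + 2 * c * (p - 1) * ((d 0 : ℝ) - α) -
      p * (p - 1) * c ^ 2 = p / C := by
    rw [hC, hc]
    field_simp
    ring
  have h1 : p / C * J - (p - 1) / C * J ≤ Q * (ε ^ (p / 2) * M) + C ^ p / C * B := by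
    rw [← hid]
    have : Q * (J + ε ^ (p / 2) * M) =
      p * (p - 1) * c ^ 2 * J + (p - 1) / C * J + Q * (ε ^ (p / 2) * M) := by rw [hQ]; ring
    linarith
  have h2 := mul_le_mul_of_nonneg_left h1 hCpos.le
  -- Young's inequality consumes `p-1` of the `p` available units of `J / C`.
  have e1 : C * (p / C * J - (p - 1) / C * J) = J := by field_simp; ring
  have e2 : C * (Q * (ε ^ (p / 2) * M) + C ^ p / C * B) =
      C * Q * (ε ^ (p / 2) * M) + C ^ p * B := by field_simp
  rw [e1, e2] at h2
  calc A ≤ J + ε ^ (p / 2) * M := hA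
    _ ≤ C * Q * (ε ^ (p / 2) * M) + C ^ p * B + ε ^ (p / 2) * M := by linarith
    _ = _ := by ring

/-- The weighted Rellich inequality for the sum of squares of the fields `X_k`. -/
theorem integral_rpow_mul_norm_rpow_le {u : Space d → ℂ} (hu : IsTest u) {p α : ℝ}
    (hp : 1 ≤ p) (hα : 2 < α) (hαN : α < d 0) :
    ∫ x, horizontalNorm x ^ (-α) * ‖u x‖ ^ p ≤
      (p ^ 2 / (((d 0 : ℝ) - α) * ((p - 1) * (d 0 : ℝ) + α - 2 * p))) ^ p *
        ∫ x, horizontalNorm x ^ (-(α - 2 * p)) * ‖∑ k, G.along k (G.along k u) x‖ ^ p := by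
  have ht : Tendsto (fun ε : ℝ => ε ^ (p / 2)) (𝓝[>] 0) (𝓝 0) := by
    have h := (Real.continuous_rpow_const (q := p / 2) (by linarith)).tendsto 0
    rw [Real.zero_rpow (by linarith)] at h
    exact h.mono_left nhdsWithin_le_nhds
  have ht2 : ∀ a b : ℝ, Tendsto (fun ε : ℝ => a + b * ε ^ (p / 2)) (𝓝[>] 0) (𝓝 a) := by
    intro a b
    simpa using (ht.const_mul b).const_add a
  exact ge_of_tendsto (ht2 _ _) (eventually_of_mem self_mem_nhdsWithin fun ε hε =>
    G.integral_rpow_mul_norm_rpow_le_add hu hp hα hαN rfl hε)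

end HomogeneousGroup

end Rellich

end Carnot

end

theorem corollary3p5 {r : ℕ} [NeZero r] {d : Fin r → ℕ} (G : Carnot.StratifiedGroup d)
    (p α : ℝ) (hp : 1 ≤ p) (hα : 2 < α) (hαN : α < (d 0 : ℝ))
    (u : Carnot.Space d → ℂ) (hu : Carnot.IsTestFunction u) :
    Integrable (fun x => ‖u x‖ ^ p / Carnot.horizontalNorm x ^ α) ∧
    Integrable (fun x => ‖G.subLaplacian u x‖ ^ p / Carnot.horizontalNorm x ^ (α - 2 * p)) ∧
    ∫ x, ‖u x‖ ^ p / Carnot.horizontalNorm x ^ α ≤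
      (p ^ 2 / (((d 0 : ℝ) - α) * ((p - 1) * (d 0 : ℝ) + α - 2 * p))) ^ p *
        ∫ x, ‖G.subLaplacian u x‖ ^ p / Carnot.horizontalNorm x ^ (α - 2 * p) := by
  have hdiv : ∀ (a β : ℝ) (x : Carnot.Space d), a / Carnot.horizontalNorm x ^ β =
      Carnot.horizontalNorm x ^ (-β) * a := fun a β x => by
    rw [Real.rpow_neg (Carnot.horizontalNorm_nonneg x), div_eq_inv_mul]
  simp_rw [hdiv]
  have hp0 : 0 < p := by linarith
  exact ⟨hu.isTest.integrable_rpow_mul_norm_rpow hp0 _,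
    (hu.isTest.sum_along_along G.toHomogeneousGroup).integrable_rpow_mul_norm_rpow hp0 _,
    G.integral_rpow_mul_norm_rpow_le hu.isTest hp hα hαN⟩
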